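/- Let $G$ be a finite complete bipartite multigraph: its vertex set is the disjoint union of two nonempty independent sets $X,Y$, and every $x\in X$ and $y\in Y$ are joined by at least one edge (parallel edges are allowed). Let every edge of $G$ be coloured with colour $1$ or $2$. A walk is \emph{alternating} if any two consecutive edges on it have different colours; for a closed walk, its last and first edge must also have different colours. A trail is a walk that repeats no edge. A 2-edge-coloured graph is \emph{supereulerian} if it contains a spanning closed alternating trail, that is, a closed alternating trail with at least one edge that visits every vertex. An \emph{eulerian factor} of $G$ is a collection of vertex-disjoint induced subgraphs $G_1,\ldots,G_k$ of $G$ that together cover $V(G)$, each of which is supereulerian. $G$ is \emph{colour-connected} if for every two distinct vertices $u,v$ there are two alternating $(u,v)$-paths $P_1,P_2$ whose union (follow $P_1$ from $u$ to $v$ and return along $P_2$) is an alternating closed walk. Then $G$ is supereulerian if and only if $G$ is colour-connected and has an eulerian factor. -/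

import Mathlib

/-! Alternating walks in multigraphs whose edges carry one of two colours.
A multigraph is a Mathlib `Graph α β` (vertex set `V(G)`, edge set `E(G)`, parallel edges allowed);
a 2-edge-colouring is a map `φ : β → Fin 2`, only whose values on `E(G)` matter. -/

open scoped Graph

namespace TwoEdgeColoured

universe u v

/-- Walks in a multigraph `G`, recording the edges that are traversed. -/
inductive Walk {α : Type u} {β : Type v} (G : Graph α β) : α → α → Type (max u v)
  | nil {x : α} (hx : x ∈ V(G)) : Walk G x x
  | cons {x y z : α} (e : β) (h : G.IsLink e x y) (p : Walk G y z) : Walk G x z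

namespace Walk

variable {α : Type u} {β : Type v} {G : Graph α β}

/-- The vertices visited by a walk, in order. -/
def support : {x y : α} → Walk G x y → List α
  | x, _, nil _ => [x]
  | x, _, cons _ _ p => x :: p.support

/-- The edges traversed by a walk, in order. -/
def edges : {x y : α} → Walk G x y → List β
  | _, _, nil _ => []
  | _, _, cons e _ p => e :: p.edges

/-- Concatenation of walks. -/
def append : {x y z : α} → Walk G x y → Walk G y z → Walk G x z
  | _, _, _, nil _, q => q
  | _, _, _, cons e h p, q => cons e h (p.append q)

/-- The walk traversed backwards. -/
def reverse : {x y : α} → Walk G x y → Walk G y x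
  | _, _, nil hx => nil hx
  | _, _, cons e h p => p.reverse.append (cons e h.symm (nil h.left_mem))

/-- A trail repeats no edge. -/
def IsTrail {x y : α} (p : Walk G x y) : Prop := p.edges.Nodup

/-- A path repeats no vertex. -/
def IsPath {x y : α} (p : Walk G x y) : Prop := p.support.Nodup

/-- Consecutive edges of the walk have different colours. -/
def IsAlternating (φ : β → Fin 2) {x y : α} (p : Walk G x y) : Prop :=
  p.edges.IsChain (fun e f => φ e ≠ φ f)

/-- Cyclically consecutive edges of the closed walk have different colours; in particular the
last and the first edge do. -/
def IsClosedAlternating (φ : β → Fin 2) {x : α} (p : Walk G x x) : Prop :=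
  Cycle.Chain (fun e f => φ e ≠ φ f) (p.edges : Cycle β)

end Walk

variable {α : Type u} {β : Type v}

/-- `G` has a spanning closed alternating trail (with at least one edge). -/
def IsSupereulerian (G : Graph α β) (φ : β → Fin 2) : Prop :=
  ∃ (x : α) (T : Walk G x x), T.edges ≠ [] ∧ T.IsTrail ∧ T.IsClosedAlternating φ ∧
    ∀ y ∈ V(G), y ∈ T.support

/-- The vertex set of `G` can be partitioned into finitely many sets, each of which induces a
supereulerian subgraph. -/
def HasEulerianFactor (G : Graph α β) (φ : β → Fin 2) : Prop :=
  ∃ (k : ℕ) (W : Fin k → Set α), Pairwise (fun i j => Disjoint (W i) (W j)) ∧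
    (⋃ i, W i) = V(G) ∧ ∀ i, IsSupereulerian (G.induce (W i)) φ

/-- Any two distinct vertices `x`, `y` are joined by two alternating `(x, y)`-paths whose union
(follow the first one, return along the second one) is an alternating closed walk. -/
def IsColourConnected (G : Graph α β) (φ : β → Fin 2) : Prop :=
  ∀ x ∈ V(G), ∀ y ∈ V(G), x ≠ y → ∃ P Q : Walk G x y,
    P.IsPath ∧ Q.IsPath ∧ P.IsAlternating φ ∧ Q.IsAlternating φ ∧
    (P.append Q.reverse).IsClosedAlternating φ

/-- `G` is a complete bipartite multigraph: `V(G)` is the union of two disjoint nonempty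
independent sets and any two vertices from different sets are joined by at least one edge. -/
def IsCompleteBipartite (G : Graph α β) : Prop :=
  ∃ X Y : Set α, X.Nonempty ∧ Y.Nonempty ∧ Disjoint X Y ∧ X ∪ Y = V(G) ∧
    (∀ a ∈ X, ∀ b ∈ X, ¬ G.Adj a b) ∧ (∀ a ∈ Y, ∀ b ∈ Y, ¬ G.Adj a b) ∧
    ∀ a ∈ X, ∀ b ∈ Y, G.Adj a b

end TwoEdgeColoured

/-! Direct edges of colour 0 from X to Y and edges of colour 1 from Y to X. At every vertex the
incoming edges have one colour and the outgoing edges the other, so an alternating walk is a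
directed walk, forwards or backwards (`Walk.IsAlternating.diWalk`). Supereulerian then means having
a spanning closed directed trail, colour-connectedness gives strong connectedness, and an eulerian
factor gives a cover of the vertices by arc-disjoint closed trails. Necessity is then direct.

Sufficiency is `exists_spanning_circuit`. In a cover of minimum size, members are vertex-disjoint
and the arcs between members form no directed cycle, since either failure would merge two members.
By finiteness some vertex v, on a member l, sends no arc outside l, so it receives an arc from every
opposite vertex off l. This property passes backwards along l: if it failed at the predecessor, two
arcs could be exchanged to merge l with another member (`false_of_exchange`). Hence every vertex of
l has it. An arc leaving l would now lie on a 2-cycle of arcs between members, so no arc leaves l,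
and strong connectedness makes l spanning. -/

namespace TwoEdgeColoured

/-! ### Directed walks and closed trails in multidigraphs. -/

section Digraph

variable {α β : Type*} {A : β → α → α → Prop}

/-- `DiWalk A u l v`: the list `l` of arcs is a directed walk from `u` to `v` in the multidigraph
in which `A e x y` says that `e` is an arc from `x` to `y`. -/
inductive DiWalk (A : β → α → α → Prop) : α → List β → α → Prop
  | nil (u : α) : DiWalk A u [] u
  | cons {u v w : α} {e : β} {l : List β} (h : A e u v) (p : DiWalk A v l w) :
      DiWalk A u (e :: l) w

namespace DiWalk

theorem append {u v w : α} {l m : List β} (p : DiWalk A u l v) (q : DiWalk A v m w) :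
    DiWalk A u (l ++ m) w := by
  induction p with
  | nil => exact q
  | cons h _ ih => exact .cons h (ih q)

theorem single {u v : α} {e : β} (h : A e u v) : DiWalk A u [e] v := .cons h (.nil v)

theorem reverse {u v : α} {l : List β} (p : DiWalk A u l v) :
    DiWalk (fun e x y => A e y x) v l.reverse u := by
  induction p with
  | nil => exact .nil _
  | cons h _ ih => simpa using ih.append (single h)

theorem mono {B : β → α → α → Prop} (hAB : ∀ e x y, A e x y → B e x y) {u v : α} {l : List β}
    (p : DiWalk A u l v) : DiWalk B u l v := by
  induction p with
  | nil => exact .nil _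
  | cons h _ ih => exact .cons (hAB _ _ _ h) ih

theorem exists_of_mem {u v : α} {l : List β} (p : DiWalk A u l v) {e : β} (he : e ∈ l) :
    ∃ s t a b, l = s ++ e :: t ∧ DiWalk A u s a ∧ A e a b ∧ DiWalk A b t v := by
  induction p with
  | nil => simp at he
  | @cons u v w f l h p ih =>
    rcases List.mem_cons.1 he with rfl | he
    · exact ⟨[], l, u, v, rfl, .nil u, h, p⟩
    · obtain ⟨s, t, a, b, rfl, hs, hab, ht⟩ := ih he
      exact ⟨f :: s, t, a, b, rfl, .cons h hs, hab, ht⟩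

/-- A nonempty directed walk contains one with the same ends that repeats no arc. -/
theorem exists_nodup (hA : ∀ e u v u' v', A e u v → A e u' v' → u = u' ∧ v = v') {u v : α}
    {l : List β} (p : DiWalk A u l v) (hl : l ≠ []) :
    ∃ m, DiWalk A u m v ∧ m ≠ [] ∧ m.Nodup := by
  induction p with
  | nil => simp at hl
  | @cons u v w e l h p ih =>
    rcases eq_or_ne l [] with rfl | hne
    · exact ⟨[e], .cons h p, by simp, by simp⟩
    · obtain ⟨m, hm, -, hnd⟩ := ih hne
      -- If `e` recurs, the walk can start at the recurrence: an arc determines its tail, so the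
      -- start is still `u`.
      by_cases hem : e ∈ m
      · obtain ⟨s, t, a, b, rfl, -, hab, ht⟩ := hm.exists_of_mem hem
        obtain ⟨rfl, rfl⟩ := hA _ _ _ _ _ h hab
        exact ⟨e :: t, .cons h ht, by simp, (List.nodup_append.1 hnd).2.1⟩
      · exact ⟨e :: m, .cons h hm, by simp, by simp [hem, hnd]⟩

end DiWalk

/-- The vertex `v` is the tail of an arc in `l`. -/
def Visits (A : β → α → α → Prop) (l : List β) (v : α) : Prop := ∃ e ∈ l, ∃ w, A e v w

/-- The list `l` of arcs is a closed directed walk with at least one arc. -/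
def IsCircuit (A : β → α → α → Prop) (l : List β) : Prop := l ≠ [] ∧ ∃ u, DiWalk A u l u

theorem Visits.mono {l m : List β} {v : α} (h : Visits A l v) (hlm : ∀ e ∈ l, e ∈ m) :
    Visits A m v := by
  obtain ⟨e, he, w, hw⟩ := h
  exact ⟨e, hlm e he, w, hw⟩

namespace IsCircuit

theorem rotate_arc (hA : ∀ e u v u' v', A e u v → A e u' v' → u = u' ∧ v = v') {l : List β}
    (hl : IsCircuit A l) {e : β} (he : e ∈ l) {a b : α} (hab : A e a b) :
    ∃ t, l.Perm (e :: t) ∧ DiWalk A b t a := by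
  obtain ⟨-, u, p⟩ := hl
  obtain ⟨s, t, a', b', rfl, hs, h, ht⟩ := p.exists_of_mem he
  obtain ⟨rfl, rfl⟩ := hA _ _ _ _ _ hab h
  exact ⟨t ++ s, List.perm_append_comm, ht.append hs⟩

theorem rotate (hA : ∀ e u v u' v', A e u v → A e u' v' → u = u' ∧ v = v') {l : List β}
    (hl : IsCircuit A l) {v : α} (hv : Visits A l v) :
    ∃ t, l.Perm t ∧ DiWalk A v t v := by
  obtain ⟨e, he, w, hw⟩ := hv
  obtain ⟨t, ht, p⟩ := hl.rotate_arc hA he hw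
  exact ⟨e :: t, ht, .cons hw p⟩

theorem visits_head (hA : ∀ e u v u' v', A e u v → A e u' v' → u = u' ∧ v = v') {l : List β}
    (hl : IsCircuit A l) {e : β} (he : e ∈ l) {a b : α} (hab : A e a b) : Visits A l b := by
  obtain ⟨t, ht, p⟩ := hl.rotate_arc hA he hab
  cases p with
  | nil => exact ⟨e, he, _, hab⟩
  | @cons _ w _ f t h p => exact ⟨f, ht.mem_iff.2 (by simp), w, h⟩

/-- Every vertex of a circuit has a predecessor on it. -/
theorem exists_pred (hA : ∀ e u v u' v', A e u v → A e u' v' → u = u' ∧ v = v') {l : List β}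
    (hl : IsCircuit A l) {v : α} (hv : Visits A l v) : ∃ e ∈ l, ∃ u, A e u v := by
  obtain ⟨e, he, w, hw⟩ := hv
  obtain ⟨t, ht, p⟩ := hl.rotate_arc hA he hw
  -- The predecessor arc is the last arc of `t`; if `t` is empty, `e` is a loop and serves itself.
  have p' := p.reverse
  generalize hs : t.reverse = s at p'
  cases p' with
  | nil => exact ⟨e, he, _, hw⟩
  | @cons _ u _ f s h p' =>
    refine ⟨f, ht.mem_iff.2 (List.mem_cons_of_mem _ ?_), u, h⟩
    rw [← List.mem_reverse, hs]; simp

theorem append (hA : ∀ e u v u' v', A e u v → A e u' v' → u = u' ∧ v = v') {l m : List β}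
    (hl : IsCircuit A l) (hm : IsCircuit A m) {v : α} (hlv : Visits A l v)
    (hmv : Visits A m v) : ∃ t, t.Perm (l ++ m) ∧ IsCircuit A t := by
  obtain ⟨l', hl', p⟩ := hl.rotate hA hlv
  obtain ⟨m', hm', q⟩ := hm.rotate hA hmv
  refine ⟨l' ++ m', (hl'.append hm').symm, fun h => hl.1 ?_, v, p.append q⟩
  have := (List.append_eq_nil_iff.1 h).1
  subst this
  exact hl'.eq_nil

end IsCircuit

/-- Membership in `S` propagates backwards from the end of the walk; on a closed trail it therefore
reaches every vertex. -/
theorem DiWalk.forall_visits_of_pred_closed {S : α → Prop} {u v : α} {l : List β}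
    (p : DiWalk A u l v) (hA : ∀ e u v u' v', A e u v → A e u' v' → u = u' ∧ v = v')
    (hS : ∀ e ∈ l, ∀ a b, A e a b → S b → S a) (hv : S v) :
    S u ∧ ∀ w, Visits A l w → S w := by
  induction p with
  | nil => exact ⟨hv, by simp [Visits]⟩
  | @cons u v w e l h p ih =>
    obtain ⟨h1, h2⟩ := ih (fun e he => hS e (by simp [he])) hv
    have hu := hS e (by simp) _ _ h h1
    refine ⟨hu, ?_⟩
    rintro x ⟨f, hf, y, hxy⟩
    rcases List.mem_cons.1 hf with rfl | hf
    · exact (hA _ _ _ _ _ h hxy).1 ▸ hu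
    · exact h2 x ⟨f, hf, y, hxy⟩

/-- `L` is a family of arc-disjoint closed trails that together visit every vertex in `V`. -/
structure IsCircuitCover (A : β → α → α → Prop) (V : Set α) (L : List (List β)) : Prop where
  nodup : L.flatten.Nodup
  circuit : ∀ l ∈ L, IsCircuit A l
  cover : ∀ v ∈ V, ∃ l ∈ L, Visits A l v

/-! ### Merging members of a minimum cover. -/

namespace IsCircuitCover

variable {V : Set α} {L : List (List β)}

theorem nodup_append (hL : IsCircuitCover A V L) {l m : List β} (hl : l ∈ L) (hm : m ∈ L)
    (hlm : l ≠ m) : (l ++ m).Nodup := by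
  obtain ⟨h1, h2⟩ := List.nodup_flatten.1 hL.nodup
  have : Std.Symm (List.Disjoint (α := β)) := ⟨fun _ _ h => h.symm⟩
  have := h2.forall hl hm hlm
  exact List.nodup_append'.2 ⟨h1 l hl, h1 m hm, this⟩

/-- In a cover of minimum size two members cannot be replaced by a single closed trail. -/
theorem false_of_merge (hL : IsCircuitCover A V L)
    (hmin : ∀ L', IsCircuitCover A V L' → L.length ≤ L'.length) {l m : List β} (hl : l ∈ L)
    (hm : m ∈ L) (hlm : l ≠ m) {t : List β} (ht : IsCircuit A t) (htn : t.Nodup)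
    (hte : ∀ e ∈ t, e ∈ l ∨ e ∈ m ∨ e ∉ L.flatten)
    (htv : ∀ v, Visits A l v ∨ Visits A m v → Visits A t v) : False := by
  classical
  have hm' : m ∈ L.erase l := (List.mem_erase_of_ne hlm.symm).2 hm
  obtain ⟨K, hK⟩ : ∃ K, L.Perm (l :: m :: K) :=
    ⟨(L.erase l).erase m, (List.perm_cons_erase hl).trans ((List.perm_cons_erase hm').cons l)⟩
  have hnd : (l ++ (m ++ K.flatten)).Nodup := by
    simpa using hK.flatten.nodup_iff.1 hL.nodup
  have hcov : IsCircuitCover A V (t :: K) := by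
    refine ⟨?_, ?_, ?_⟩
    · rw [List.flatten_cons, List.nodup_append']
      rw [List.nodup_append', List.nodup_append'] at hnd
      refine ⟨htn, hnd.2.1.2.1, fun e he heK => ?_⟩
      rcases hte e he with h | h | h
      · exact hnd.2.2 h (by simp only [List.mem_append]; exact .inr heK)
      · exact hnd.2.1.2.2 h heK
      · refine h (hK.flatten.mem_iff.2 ?_)
        simp only [List.flatten_cons, List.mem_append]
        exact .inr (.inr heK)
    · intro k hk
      rcases List.mem_cons.1 hk with rfl | hk
      · exact ht
      · exact hL.circuit k (hK.mem_iff.2 (by simp [hk]))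
    · intro v hv
      obtain ⟨k, hk, hkv⟩ := hL.cover v hv
      have := hK.mem_iff.1 hk
      simp only [List.mem_cons] at this
      rcases this with rfl | rfl | hk
      · exact ⟨t, by simp, htv v (.inl hkv)⟩
      · exact ⟨t, by simp, htv v (.inr hkv)⟩
      · exact ⟨k, by simp [hk], hkv⟩
  have h1 := hmin _ hcov
  have h2 := hK.length_eq
  simp only [List.length_cons] at h1 h2
  omega

theorem eq_of_visits (hA : ∀ e u v u' v', A e u v → A e u' v' → u = u' ∧ v = v')
    (hL : IsCircuitCover A V L) (hmin : ∀ L', IsCircuitCover A V L' → L.length ≤ L'.length)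
    {l m : List β} (hl : l ∈ L) (hm : m ∈ L) {v : α} (hlv : Visits A l v)
    (hmv : Visits A m v) : l = m := by
  by_contra hlm
  obtain ⟨t, ht, htc⟩ := (hL.circuit l hl).append hA (hL.circuit m hm) hlv hmv
  refine hL.false_of_merge hmin hl hm hlm htc (ht.nodup_iff.2 (hL.nodup_append hl hm hlm)) ?_ ?_
  · intro e he
    have := ht.mem_iff.1 he
    simp only [List.mem_append] at this
    tauto
  · rintro v (h | h) <;> exact h.mono fun e he => ht.mem_iff.2 (by simp [he])

/-- In a cover of minimum size no closed trail consists of arcs between different members. -/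
theorem false_of_cross_circuit (hA : ∀ e u v u' v', A e u v → A e u' v' → u = u' ∧ v = v')
    (hAV : ∀ e u v, A e u v → u ∈ V ∧ v ∈ V)
    (hL : IsCircuitCover A V L) (hmin : ∀ L', IsCircuitCover A V L' → L.length ≤ L'.length)
    {z : List β} {u : α} (hz : z ≠ [])
    (p : DiWalk (fun e x y => A e x y ∧ ∀ l ∈ L, ¬ (Visits A l x ∧ Visits A l y)) u z u) :
    False := by
  obtain ⟨z, p, hz, hzn⟩ := p.exists_nodup (fun e u v u' v' h h' => hA e u v u' v' h.1 h'.1) hz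
  -- An arc used by the cover has both ends on one member, so it is not a cross arc.
  have hzL : ∀ e ∈ z, e ∉ L.flatten := by
    intro e he heL
    obtain ⟨l, hl, hel⟩ := List.mem_flatten.1 heL
    obtain ⟨-, -, a, b, -, -, h, -⟩ := p.exists_of_mem he
    exact h.2 l hl ⟨⟨e, hel, b, h.1⟩, (hL.circuit l hl).visits_head hA hel h.1⟩
  have q : DiWalk A u z u := p.mono fun e x y h => h.1
  have hzc : IsCircuit A z := ⟨hz, u, q⟩
  cases p with
  | nil => exact hz rfl
  | @cons _ w _ e s h p =>
    obtain ⟨l, hl, hlu⟩ := hL.cover u (hAV _ _ _ h.1).1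
    obtain ⟨m, hm, hmw⟩ := hL.cover w (hAV _ _ _ h.1).2
    have hlm : l ≠ m := by
      rintro rfl
      exact h.2 l hl ⟨hlu, hmw⟩
    have hzu : Visits A (e :: s) u := ⟨e, by simp, w, h.1⟩
    have hzw : Visits A (e :: s) w := hzc.visits_head hA (by simp) h.1
    -- The closed trail meets `l` at `u` and `m` at `w`, so it glues them together.
    obtain ⟨t, ht, htc⟩ := (hL.circuit l hl).append hA hzc hlu hzu
    obtain ⟨r, hr, hrc⟩ := htc.append hA (hL.circuit m hm)
      (hzw.mono fun f hf => ht.mem_iff.2 (List.mem_append_right _ hf)) hmw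
    have hperm : r.Perm ((l ++ m) ++ (e :: s)) := by
      refine (hr.trans (ht.append_right m)).trans ?_
      rw [List.append_assoc, List.append_assoc]
      exact List.perm_append_comm.append_left l
    refine hL.false_of_merge hmin hl hm hlm hrc (hperm.nodup_iff.2 ?_) ?_ ?_
    · refine List.nodup_append'.2 ⟨hL.nodup_append hl hm hlm, hzn, fun f hf hfz => ?_⟩
      refine hzL f hfz (List.mem_flatten.2 ?_)
      rcases List.mem_append.1 hf with h | h
      exacts [⟨l, hl, h⟩, ⟨m, hm, h⟩]
    · intro f hf
      rcases List.mem_append.1 (hperm.mem_iff.1 hf) with h | h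
      · rcases List.mem_append.1 h with h | h
        exacts [.inl h, .inr (.inl h)]
      · exact .inr (.inr (hzL f h))
    · rintro v (h | h) <;> refine h.mono fun f hf => hperm.mem_iff.2 ?_ <;>
        simp only [List.mem_append] <;> tauto

/-- In a cover of minimum size, arcs `a → b` and `c → d` of different members cannot be
exchanged for arcs `a → d` and `c → b`. -/
theorem false_of_exchange (hA : ∀ e u v u' v', A e u v → A e u' v' → u = u' ∧ v = v')
    (hL : IsCircuitCover A V L) (hmin : ∀ L', IsCircuitCover A V L' → L.length ≤ L'.length)
    {l m : List β} (hl : l ∈ L) (hm : m ∈ L) (hlm : l ≠ m) {a b c d : α} {e f g h : β}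
    (he : e ∈ l) (hf : f ∈ m) (hab : A e a b) (hcd : A f c d) (had : A g a d)
    (hcb : A h c b) : False := by
  have hlc := hL.circuit l hl
  have hmc := hL.circuit m hm
  have hla : Visits A l a := ⟨e, he, b, hab⟩
  have hmc' : Visits A m c := ⟨f, hf, d, hcd⟩
  have hlb := hlc.visits_head hA he hab
  have hmd := hmc.visits_head hA hf hcd
  -- The two new arcs are unused by the cover: a member using one would meet both `l` and `m`.
  have cross : ∀ k x y, A k x y → (Visits A l x ∧ Visits A m y) ∨ (Visits A m x ∧ Visits A l y) →
      k ∉ L.flatten := by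
    intro k x y hk hxy hkL
    obtain ⟨n, hn, hkn⟩ := List.mem_flatten.1 hkL
    have h1 : Visits A n x := ⟨k, hkn, y, hk⟩
    have h2 := (hL.circuit n hn).visits_head hA hkn hk
    rcases hxy with ⟨hx, hy⟩ | ⟨hx, hy⟩
    · exact hlm ((hL.eq_of_visits hA hmin hl hn hx h1).trans
        (hL.eq_of_visits hA hmin hn hm h2 hy))
    · exact hlm ((hL.eq_of_visits hA hmin hl hn hy h2).trans
        (hL.eq_of_visits hA hmin hn hm h1 hx))
  have hg := cross g a d had (.inl ⟨hla, hmd⟩)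
  have hh := cross h c b hcb (.inr ⟨hmc', hlb⟩)
  have hgh : g ≠ h := by
    rintro rfl
    obtain ⟨rfl, -⟩ := hA _ _ _ _ _ had hcb
    exact hlm (hL.eq_of_visits hA hmin hl hm hla hmc')
  obtain ⟨s, hs, p⟩ := hlc.rotate_arc hA he hab
  obtain ⟨t, ht, q⟩ := hmc.rotate_arc hA hf hcd
  have hsl : ∀ x ∈ s, x ∈ l := fun x hx => hs.mem_iff.2 (by simp [hx])
  have htm : ∀ x ∈ t, x ∈ m := fun x hx => ht.mem_iff.2 (by simp [hx])
  have hfl : ∀ x, x ∈ l → x ∈ L.flatten := fun x hx => List.mem_flatten.2 ⟨l, hl, hx⟩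
  have hfm : ∀ x, x ∈ m → x ∈ L.flatten := fun x hx => List.mem_flatten.2 ⟨m, hm, hx⟩
  have hnd : ((e :: s) ++ (f :: t)).Nodup :=
    (hs.append ht).nodup_iff.1 (hL.nodup_append hl hm hlm)
  simp only [List.nodup_append', List.nodup_cons, List.disjoint_cons_left,
    List.disjoint_cons_right] at hnd
  -- The merged trail is a → d, along `m` to c, then c → b, along `l` back to a.
  refine hL.false_of_merge hmin hl hm hlm (t := g :: (t ++ h :: s))
    ⟨by simp, a, .cons had (q.append (.cons hcb p))⟩ ?_ ?_ ?_
  · simp only [List.nodup_append', List.nodup_cons, List.disjoint_cons_right, List.mem_append,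
      List.mem_cons]
    exact ⟨fun hgm => hgm.elim (fun hgt => hg (hfm g (htm g hgt))) fun hgm =>
        hgm.elim hgh fun hgs => hg (hfl g (hsl g hgs)),
      hnd.2.1.2, ⟨fun hhs => hh (hfl h (hsl h hhs)), hnd.1.2⟩,
      fun hht => hh (hfm h (htm h hht)), hnd.2.2.2.2.symm⟩
  · intro x hx
    simp only [List.mem_append, List.mem_cons] at hx
    rcases hx with rfl | hx | rfl | hx
    exacts [.inr (.inr hg), .inr (.inl (htm x hx)), .inr (.inr hh), .inl (hsl x hx)]
  · rintro v (⟨x, hx, w, hw⟩ | ⟨x, hx, w, hw⟩)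
    · rcases List.mem_cons.1 (hs.mem_iff.1 hx) with rfl | hx
      · exact ⟨g, by simp, d, (hA _ _ _ _ _ hw hab).1 ▸ had⟩
      · exact ⟨x, by simp [hx], w, hw⟩
    · rcases List.mem_cons.1 (ht.mem_iff.1 hx) with rfl | hx
      · exact ⟨h, by simp, b, (hA _ _ _ _ _ hw hcd).1 ▸ hcb⟩
      · exact ⟨x, by simp [hx], w, hw⟩

end IsCircuitCover

/-! ### Spanning closed trails in strong bipartite multidigraphs. -/

theorem exists_sink_of_acyclic {V : Set α} (hV : V.Finite) (hne : V.Nonempty)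
    (hacyc : ∀ u l, l ≠ [] → ¬ DiWalk A u l u) :
    ∃ v ∈ V, ∀ w ∈ V, ∀ e, ¬ A e v w := by
  have := hV.to_subtype
  have := hne.to_subtype
  let R : V → V → Prop := fun w v => ∃ l, l ≠ [] ∧ DiWalk A (v : α) l w
  have : IsTrans V R := ⟨by
    rintro a b c ⟨l, hl, p⟩ ⟨m, hm, q⟩
    exact ⟨m ++ l, by simp [hl], q.append p⟩⟩
  have : Std.Irrefl R := ⟨by
    rintro a ⟨l, hl, p⟩
    exact hacyc _ _ hl p⟩
  obtain ⟨v, -, hv⟩ := (Finite.wellFounded_of_trans_of_irrefl R).has_min Set.univ Set.univ_nonempty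
  exact ⟨v, v.2, fun w hw e he => hv ⟨w, hw⟩ trivial ⟨[e], by simp, .single he⟩⟩

theorem DiWalk.mem_of_closed {S : α → Prop} (hS : ∀ e a b, A e a b → S a → S b) {u v : α}
    {l : List β} (p : DiWalk A u l v) (hu : S u) : S v := by
  induction p with
  | nil => exact hu
  | cons h _ ih => exact ih (hS _ _ _ h hu)

/-- A strong semicomplete bipartite multidigraph whose vertices can be covered by arc-disjoint
closed trails has a spanning closed trail. -/
theorem exists_spanning_circuit {X Y : Set α} (hXY : Disjoint X Y) (hfin : (X ∪ Y).Finite)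
    (hne : (X ∪ Y).Nonempty)
    (hA : ∀ e u v u' v', A e u v → A e u' v' → u = u' ∧ v = v')
    (hbip : ∀ e u v, A e u v → (u ∈ X ∧ v ∈ Y) ∨ (u ∈ Y ∧ v ∈ X))
    (hcomp : ∀ x ∈ X, ∀ y ∈ Y, ∃ e, A e x y ∨ A e y x)
    (hstrong : ∀ u ∈ X ∪ Y, ∀ v ∈ X ∪ Y, ∃ l, DiWalk A u l v)
    (hcov : ∃ L, IsCircuitCover A (X ∪ Y) L) :
    ∃ l, IsCircuit A l ∧ l.Nodup ∧ ∀ v ∈ X ∪ Y, Visits A l v := by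
  classical
  obtain ⟨L, hL, hmin⟩ : ∃ L, IsCircuitCover A (X ∪ Y) L ∧
      ∀ L', IsCircuitCover A (X ∪ Y) L' → L.length ≤ L'.length := by
    let S : Set (List (List β)) := {L | IsCircuitCover A (X ∪ Y) L}
    obtain ⟨L, hL, h⟩ := (measure (α := List (List β)) List.length).wf.has_min S hcov
    exact ⟨L, hL, fun L' hL' => not_lt.1 (h L' hL')⟩
  have hAV : ∀ e u v, A e u v → u ∈ X ∪ Y ∧ v ∈ X ∪ Y := fun e u v h => by
    rcases hbip e u v h with h | h
    exacts [⟨.inl h.1, .inr h.2⟩, ⟨.inr h.1, .inl h.2⟩]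
  let opp : α → α → Prop := fun u v => (u ∈ X ∧ v ∈ Y) ∨ (u ∈ Y ∧ v ∈ X)
  have hopp : ∀ u v, opp u v → ∃ e, A e u v ∨ A e v u := by
    rintro u v (⟨hu, hv⟩ | ⟨hu, hv⟩)
    · exact hcomp u hu v hv
    · obtain ⟨e, he⟩ := hcomp v hv u hu
      exact ⟨e, he.symm⟩
  have hnot : ∀ x, x ∈ X → x ∈ Y → False := fun x hx hy => Set.disjoint_left.1 hXY hx hy
  have hacyc := fun u z hz p => hL.false_of_cross_circuit hA hAV hmin (z := z) (u := u) hz p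
  obtain ⟨v, hvV, hv⟩ := exists_sink_of_acyclic hfin hne hacyc
  obtain ⟨l, hl, hlv⟩ := hL.cover v hvV
  have hlc := hL.circuit l hl
  have cross : ∀ u w, Visits A l u → ¬ Visits A l w →
      ∀ k ∈ L, ¬ (Visits A k u ∧ Visits A k w) := by
    rintro u w hu hw k hk ⟨hku, hkw⟩
    exact hw (hL.eq_of_visits hA hmin hk hl hku hu ▸ hkw)
  -- The property carried backwards around `l`, starting from the sink `v` of the cross arcs.
  let S : α → Prop := fun u => Visits A l u ∧ ∀ w, opp w u → ¬ Visits A l w → ∃ e, A e w u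
  have hSv : S v := by
    refine ⟨hlv, fun w hwv hw => ?_⟩
    obtain ⟨e, he | he⟩ := hopp w v hwv
    · exact ⟨e, he⟩
    · exact (hv w (hAV _ _ _ he).2 e ⟨he, cross v w hlv hw⟩).elim
  have hSpred : ∀ e ∈ l, ∀ a b, A e a b → S b → S a := by
    rintro e he a b hab ⟨hlb, hb⟩
    refine ⟨⟨e, he, b, hab⟩, fun d hda hd => ?_⟩
    obtain ⟨m, hm, hmd⟩ := hL.cover d (by rcases hda with h | h; exacts [.inl h.1, .inr h.1])
    obtain ⟨f, hf, c, hcd⟩ := (hL.circuit m hm).exists_pred hA hmd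
    have hlm : l ≠ m := by
      rintro rfl
      exact hd hmd
    have hmc : Visits A m c := ⟨f, hf, d, hcd⟩
    have hlc' : ¬ Visits A l c := fun h => hlm (hL.eq_of_visits hA hmin hl hm h hmc)
    -- Both a and c lie opposite d, hence on the same side, and b lies opposite a.
    have hcb : opp c b := by
      have h1 := hbip _ _ _ hab
      have h2 := hbip _ _ _ hcd
      have h3 := hnot a
      have h4 := hnot d
      simp only [opp] at hda ⊢
      tauto
    obtain ⟨h, hcb⟩ := hb c hcb hlc'
    obtain ⟨g, hg | hg⟩ := hopp d a hda
    · exact ⟨g, hg⟩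
    · exact (hL.false_of_exchange hA hmin hl hm hlm he hf hab hcd hg hcb).elim
  have hS : ∀ u, Visits A l u → S u := by
    obtain ⟨t, ht, p⟩ := hlc.rotate hA hlv
    intro u hu
    exact (p.forall_visits_of_pred_closed hA (fun e he => hSpred e (ht.mem_iff.2 he)) hSv).2 u
      (hu.mono fun e he => ht.mem_iff.1 he)
  refine ⟨l, hlc, (List.nodup_flatten.1 hL.nodup).1 l hl, fun w hw => ?_⟩
  obtain ⟨t, p⟩ := hstrong v hvV w hw
  refine p.mem_of_closed (fun e a b hab ha => ?_) hlv
  by_contra hb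
  have hba : opp b a := by
    have := hbip _ _ _ hab
    simp only [opp]
    tauto
  obtain ⟨f, hf⟩ := (hS a ha).2 b hba hb
  exact hacyc a [e, f] (by simp) (.cons ⟨hab, cross a b ha hb⟩
    (.single ⟨hf, fun k hk h => cross a b ha hb k hk h.symm⟩))

end Digraph

/-! ### Alternating walks as directed walks. -/

section Orientation

variable {α β : Type*} {G : Graph α β} {φ : β → Fin 2} {X Y : Set α}

namespace Walk

@[simp]
theorem edges_append {x y z : α} (p : Walk G x y) (q : Walk G y z) :
    (p.append q).edges = p.edges ++ q.edges := by
  induction p with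
  | nil => rfl
  | cons e h p ih => simp [append, edges, ih]

@[simp]
theorem edges_reverse {x y : α} (p : Walk G x y) : p.reverse.edges = p.edges.reverse := by
  induction p with
  | nil => rfl
  | cons e h p ih => simp [reverse, edges, ih]

theorem start_mem_support {x y : α} (p : Walk G x y) : x ∈ p.support := by
  cases p <;> simp [support]

theorem mem_support_append_right {x y z w : α} (p : Walk G x y) (q : Walk G y z)
    (hw : w ∈ q.support) : w ∈ (p.append q).support := by
  induction p with
  | nil => exact hw
  | cons e h p ih => exact List.mem_cons_of_mem _ (ih q hw)

theorem support_append_single {x y z : α} (p : Walk G x y) {e : β} (h : G.IsLink e y z)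
    (hz : z ∈ V(G)) : (p.append (cons e h (nil hz))).support = p.support ++ [z] := by
  induction p with
  | nil => rfl
  | cons f h p ih => simp [append, support, ih]

theorem support_reverse {x y : α} (p : Walk G x y) : p.reverse.support = p.support.reverse := by
  induction p with
  | nil => rfl
  | cons e h p ih => simp [reverse, support, support_append_single, ih]

theorem exists_isLink_of_mem_edges {x y : α} (p : Walk G x y) {e : β} (he : e ∈ p.edges) :
    ∃ u v, G.IsLink e u v := by
  induction p with
  | nil => simp [edges] at he
  | @cons x y z f h p ih =>
    rcases List.mem_cons.1 he with rfl | he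
    exacts [⟨x, y, h⟩, ih he]

theorem edges_ne_nil {x y : α} (p : Walk G x y) (hxy : x ≠ y) : p.edges ≠ [] := by
  cases p with
  | nil => exact (hxy rfl).elim
  | cons => simp [edges]

theorem IsClosedAlternating.isAlternating {x : α} {p : Walk G x x}
    (hp : p.IsClosedAlternating φ) : p.IsAlternating φ := by
  unfold IsClosedAlternating at hp
  unfold IsAlternating
  cases h : p.edges with
  | nil => simp
  | cons e l =>
    rw [h, Cycle.chain_coe_cons] at hp
    exact List.IsChain.left_of_append (l₂ := [e]) hp

/-- The vertices of a walk along directed arcs are its end and the tails of its arcs. -/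
theorem visits_of_mem_support {A : β → α → α → Prop} (hA : ∀ e u v, A e u v → G.IsLink e u v)
    {x y : α} (p : Walk G x y) (hp : DiWalk A x p.edges y) {v : α} (hv : v ∈ p.support) :
    Visits A p.edges v ∨ v = y := by
  induction p with
  | nil => simpa [support] using Or.inr hv
  | @cons x y z e h p ih =>
    simp only [edges] at hp ⊢
    cases hp with
    | @cons _ y' _ _ _ h' q =>
      obtain rfl := (hA _ _ _ h').right_unique h
      rcases List.mem_cons.1 hv with rfl | hv
      · exact .inl ⟨e, by simp, _, h'⟩
      · exact (ih q hv).imp_left fun h => h.mono fun f hf => by simp [hf]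

theorem mem_support_of_visits {A : β → α → α → Prop} (hA : ∀ e u v, A e u v → G.IsLink e u v)
    (hA' : ∀ e u v u' v', A e u v → A e u' v' → u = u' ∧ v = v')
    {x y : α} (p : Walk G x y) (hp : DiWalk A x p.edges y) {v : α} (hv : Visits A p.edges v) :
    v ∈ p.support := by
  induction p with
  | nil => simp [Visits, edges] at hv
  | @cons x y z e h p ih =>
    simp only [edges] at hp
    cases hp with
    | @cons _ y' _ _ _ h' q =>
      obtain rfl := (hA _ _ _ h').right_unique h
      obtain ⟨f, hf, w, hw⟩ := hv
      rcases List.mem_cons.1 hf with rfl | hf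
      · simp [support, (hA' _ _ _ _ _ hw h').1]
      · exact List.mem_cons_of_mem _ (ih q ⟨f, hf, w, hw⟩)

end Walk

theorem DiWalk.exists_walk {A : β → α → α → Prop} (hA : ∀ e u v, A e u v → G.IsLink e u v)
    {x y : α} {l : List β} (p : DiWalk A x l y) (hy : y ∈ V(G)) :
    ∃ q : Walk G x y, q.edges = l := by
  induction p with
  | nil => exact ⟨.nil hy, rfl⟩
  | cons h _ ih =>
    obtain ⟨q, rfl⟩ := ih hy
    exact ⟨.cons _ (hA _ _ _ h) q, rfl⟩

theorem Walk.exists_suffix {A : β → α → α → Prop} (hA : ∀ e u v, A e u v → G.IsLink e u v)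
    {x y : α} (p : Walk G x y) (hp : DiWalk A x p.edges y) {v : α} (hv : v ∈ p.support) :
    ∃ q : Walk G v y, q.support <:+ p.support ∧ DiWalk A v q.edges y := by
  induction p with
  | nil hx =>
    obtain rfl : v = _ := by simpa [support] using hv
    exact ⟨.nil hx, List.suffix_rfl, hp⟩
  | @cons x y z e h p ih =>
    by_cases hvx : v = x
    · subst hvx
      exact ⟨.cons e h p, List.suffix_rfl, hp⟩
    · simp only [edges] at hp
      cases hp with
      | @cons _ y' _ _ _ h' q =>
        obtain rfl := (hA _ _ _ h').right_unique h
        obtain ⟨r, hr, hr'⟩ := ih q ((List.mem_cons.1 hv).resolve_left hvx)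
        exact ⟨r, hr.trans (List.suffix_cons _ _), hr'⟩

/-- The vertices joined by a directed walk are joined by a directed path. -/
theorem DiWalk.exists_path {A : β → α → α → Prop} (hA : ∀ e u v, A e u v → G.IsLink e u v)
    {x y : α} {l : List β} (p : DiWalk A x l y) (hy : y ∈ V(G)) :
    ∃ q : Walk G x y, q.IsPath ∧ DiWalk A x q.edges y := by
  induction p with
  | nil x => exact ⟨.nil hy, by simp [Walk.IsPath, Walk.support], .nil x⟩
  | @cons x y z e l h _ ih =>
    obtain ⟨q, hq, hq'⟩ := ih hy
    by_cases hx : x ∈ q.support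
    · obtain ⟨r, hr, hr'⟩ := q.exists_suffix hA hq' hx
      exact ⟨r, hr.sublist.nodup hq, hr'⟩
    · exact ⟨.cons e (hA _ _ _ h) q, List.nodup_cons.2 ⟨hx, hq⟩, .cons h hq'⟩

/-- Edges of colour `0` are directed from `X` to `Y`, those of colour `1` from `Y` to `X`. -/
def Arc (G : Graph α β) (φ : β → Fin 2) (X Y : Set α) (e : β) (u v : α) : Prop :=
  G.IsLink e u v ∧ ((u ∈ X ∧ φ e = 0) ∨ (u ∈ Y ∧ φ e = 1))

namespace Arc

theorem isLink {e : β} {u v : α} (h : Arc G φ X Y e u v) : G.IsLink e u v := h.1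

/-- The ends of an edge lie on different sides, and its colour selects which side holds the tail. -/
theorem unique (hXY : Disjoint X Y)
    (hG : ∀ e u v, G.IsLink e u v → (u ∈ X ∧ v ∈ Y) ∨ (u ∈ Y ∧ v ∈ X)) (e : β) (u v u' v' : α)
    (h : Arc G φ X Y e u v) (h' : Arc G φ X Y e u' v') : u = u' ∧ v = v' := by
  rcases h.1.eq_and_eq_or_eq_and_eq h'.1 with h1 | ⟨rfl, rfl⟩
  · exact h1
  · have h1 := hG _ _ _ h.1
    have h2 : u ∈ X → u ∉ Y := fun h => Set.disjoint_left.1 hXY h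
    have h3 : v ∈ X → v ∉ Y := fun h => Set.disjoint_left.1 hXY h
    have h4 : (0 : Fin 2) ≠ 1 := by decide
    obtain ⟨-, h⟩ := h
    obtain ⟨-, h'⟩ := h'
    grind

theorem or_symm (hG : ∀ e u v, G.IsLink e u v → (u ∈ X ∧ v ∈ Y) ∨ (u ∈ Y ∧ v ∈ X)) {e : β}
    {u v : α} (h : G.IsLink e u v) : Arc G φ X Y e u v ∨ Arc G φ X Y e v u := by
  have h1 := hG _ _ _ h
  have h2 := h.symm
  have h3 : φ e = 0 ∨ φ e = 1 := by omega
  unfold Arc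
  tauto

theorem colour_ne (hXY : Disjoint X Y)
    (hG : ∀ e u v, G.IsLink e u v → (u ∈ X ∧ v ∈ Y) ∨ (u ∈ Y ∧ v ∈ X)) {e f : β} {u v w : α}
    (he : Arc G φ X Y e u v) (hf : Arc G φ X Y f v w) : φ e ≠ φ f := by
  have h1 := hG _ _ _ he.1
  have h2 : u ∈ X → u ∉ Y := fun h => Set.disjoint_left.1 hXY h
  have h3 : v ∈ X → v ∉ Y := fun h => Set.disjoint_left.1 hXY h
  have h4 : (0 : Fin 2) ≠ 1 := by decide
  obtain ⟨-, he⟩ := he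
  obtain ⟨-, hf⟩ := hf
  grind

theorem colour_eq_of_heads (hXY : Disjoint X Y)
    (hG : ∀ e u v, G.IsLink e u v → (u ∈ X ∧ v ∈ Y) ∨ (u ∈ Y ∧ v ∈ X)) {e f : β} {u v w : α}
    (he : Arc G φ X Y e u v) (hf : Arc G φ X Y f w v) : φ e = φ f := by
  have h1 := hG _ _ _ he.1
  have h1' := hG _ _ _ hf.1
  have h2 : u ∈ X → u ∉ Y := fun h => Set.disjoint_left.1 hXY h
  have h3 : v ∈ X → v ∉ Y := fun h => Set.disjoint_left.1 hXY h
  have h3' : w ∈ X → w ∉ Y := fun h => Set.disjoint_left.1 hXY h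
  obtain ⟨-, he⟩ := he
  obtain ⟨-, hf⟩ := hf
  grind

theorem colour_eq_of_tails (hXY : Disjoint X Y) {e f : β} {u v w : α}
    (he : Arc G φ X Y e v u) (hf : Arc G φ X Y f v w) : φ e = φ f := by
  have h3 : v ∈ X → v ∉ Y := fun h => Set.disjoint_left.1 hXY h
  obtain ⟨-, he⟩ := he
  obtain ⟨-, hf⟩ := hf
  grind

end Arc

theorem DiWalk.isChain_colour (hXY : Disjoint X Y)
    (hG : ∀ e u v, G.IsLink e u v → (u ∈ X ∧ v ∈ Y) ∨ (u ∈ Y ∧ v ∈ X)) {x y : α} {l : List β}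
    (p : DiWalk (Arc G φ X Y) x l y) : l.IsChain (fun e f => φ e ≠ φ f) := by
  induction p with
  | nil => simp
  | cons h p ih =>
    cases p with
    | nil => simp
    | cons h' p => exact List.isChain_cons_cons.2 ⟨h.colour_ne hXY hG h', ih⟩

theorem DiWalk.cycle_chain_colour (hXY : Disjoint X Y)
    (hG : ∀ e u v, G.IsLink e u v → (u ∈ X ∧ v ∈ Y) ∨ (u ∈ Y ∧ v ∈ X)) {x : α} {l : List β}
    (p : DiWalk (Arc G φ X Y) x l x) :
    Cycle.Chain (fun e f => φ e ≠ φ f) (l : Cycle β) := by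
  cases l with
  | nil => exact Cycle.Chain.nil _
  | cons e l =>
    rw [Cycle.chain_coe_cons]
    obtain ⟨y, hy⟩ : ∃ y, Arc G φ X Y e x y := by
      cases p with
      | cons h p => exact ⟨_, h⟩
    simpa using (p.append (.single hy)).isChain_colour hXY hG

/-- An alternating walk follows the arcs all along or goes against them all along. -/
theorem Walk.IsAlternating.diWalk (hXY : Disjoint X Y)
    (hG : ∀ e u v, G.IsLink e u v → (u ∈ X ∧ v ∈ Y) ∨ (u ∈ Y ∧ v ∈ X)) {x y : α}
    {p : Walk G x y} (hp : p.IsAlternating φ) :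
    DiWalk (Arc G φ X Y) x p.edges y ∨
      DiWalk (fun e u v => Arc G φ X Y e v u) x p.edges y := by
  induction p with
  | nil => exact .inl (.nil _)
  | @cons x y z e h p ih =>
    cases p with
    | nil => exact (Arc.or_symm hG h).imp (fun h => .single h) (fun h => .single h)
    | @cons _ w _ f h' p =>
      obtain ⟨hef, hp⟩ := List.isChain_cons_cons.1 hp
      rcases ih hp with q | q
      · left
        rcases Arc.or_symm (φ := φ) hG h with h1 | h1
        · exact .cons h1 q
        · cases q with
          | cons h2 _ => exact (hef (h1.colour_eq_of_tails hXY h2)).elim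
      · right
        rcases Arc.or_symm (φ := φ) hG h with h1 | h1
        · cases q with
          | cons h2 _ => exact (hef (h1.colour_eq_of_heads hXY hG h2)).elim
        · exact .cons h1 q

/-- The edges of a closed alternating walk form a circuit, possibly in the reverse order. -/
theorem Walk.IsClosedAlternating.exists_circuit (hXY : Disjoint X Y)
    (hG : ∀ e u v, G.IsLink e u v → (u ∈ X ∧ v ∈ Y) ∨ (u ∈ Y ∧ v ∈ X)) {x : α}
    {p : Walk G x x} (hp : p.IsClosedAlternating φ) (hne : p.edges ≠ []) :
    ∃ l, l.Perm p.edges ∧ IsCircuit (Arc G φ X Y) l ∧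
      ∀ v ∈ p.support, Visits (Arc G φ X Y) l v := by
  have hA := Arc.unique (φ := φ) hXY hG
  rcases hp.isAlternating.diWalk hXY hG with q | q
  · refine ⟨p.edges, .refl _, ⟨hne, x, q⟩, fun v hv => ?_⟩
    rcases p.visits_of_mem_support (fun _ _ _ h => h.isLink) q hv with h | rfl
    · exact h
    · generalize p.edges = l at q hne
      cases q with
      | nil => exact (hne rfl).elim
      | cons h _ => exact ⟨_, by simp, _, h⟩
  · have hc : IsCircuit (Arc G φ X Y) p.edges.reverse := ⟨by simpa using hne, x, q.reverse⟩
    refine ⟨p.edges.reverse, List.reverse_perm _, hc, fun v hv => ?_⟩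
    rcases p.visits_of_mem_support (fun _ _ _ h => h.isLink.symm) q hv with h | rfl
    · obtain ⟨e, he, w, hw⟩ := h
      exact hc.visits_head hA (by simpa using he) hw
    · have h : ∃ e ∈ p.edges, ∃ w, Arc G φ X Y e w v := by
        generalize p.edges = l at q hne
        cases q with
        | nil => exact (hne rfl).elim
        | cons h _ => exact ⟨_, by simp, _, h⟩
      obtain ⟨e, he, w, hw⟩ := h
      exact hc.visits_head hA (by simpa using he) hw

theorem IsCircuit.exists_diWalk {A : β → α → α → Prop}
    (hA : ∀ e u v u' v', A e u v → A e u' v' → u = u' ∧ v = v') {l : List β}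
    (hl : IsCircuit A l) {u v : α} (hu : Visits A l u) (hv : Visits A l v) :
    ∃ m, DiWalk A u m v := by
  obtain ⟨t, ht, p⟩ := hl.rotate hA hu
  obtain ⟨e, he, w, hw⟩ := hv
  obtain ⟨s, -, a, b, -, hs, hab, -⟩ := p.exists_of_mem (ht.mem_iff.1 he)
  obtain ⟨rfl, -⟩ := hA _ _ _ _ _ hw hab
  exact ⟨s, hs⟩

theorem isSupereulerian_of_circuit (hXY : Disjoint X Y)
    (hG : ∀ e u v, G.IsLink e u v → (u ∈ X ∧ v ∈ Y) ∨ (u ∈ Y ∧ v ∈ X)) {l : List β}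
    (hl : IsCircuit (Arc G φ X Y) l) (hn : l.Nodup)
    (hV : ∀ v ∈ V(G), Visits (Arc G φ X Y) l v) : IsSupereulerian G φ := by
  obtain ⟨hne, x, p⟩ := hl
  have hx : x ∈ V(G) := by
    cases p with
    | nil => exact (hne rfl).elim
    | cons h _ => exact h.isLink.left_mem
  obtain ⟨q, rfl⟩ := p.exists_walk (fun _ _ _ h => h.isLink) hx
  exact ⟨x, q, hne, hn, p.cycle_chain_colour hXY hG, fun v hv =>
    q.mem_support_of_visits (fun _ _ _ h => h.isLink) (Arc.unique hXY hG) p (hV v hv)⟩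

/-- The spanning trail contains directed walks from x to y and from y to x. Shorten both to paths;
the second, reversed, serves as `Q`. -/
theorem IsSupereulerian.isColourConnected (hXY : Disjoint X Y)
    (hG : ∀ e u v, G.IsLink e u v → (u ∈ X ∧ v ∈ Y) ∨ (u ∈ Y ∧ v ∈ X))
    (h : IsSupereulerian G φ) : IsColourConnected G φ := by
  have hA := Arc.unique (φ := φ) hXY hG
  obtain ⟨z, T, hne, -, hT, hV⟩ := h
  obtain ⟨l, -, hl, hlV⟩ := hT.exists_circuit hXY hG hne
  intro x hx y hy hxy
  have hvx := hlV x (hV x hx)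
  have hvy := hlV y (hV y hy)
  obtain ⟨m, hm⟩ := hl.exists_diWalk hA hvx hvy
  obtain ⟨n, hn⟩ := hl.exists_diWalk hA hvy hvx
  obtain ⟨P, hP, hP'⟩ := hm.exists_path (fun _ _ _ h => h.isLink) hy
  obtain ⟨Q, hQ, hQ'⟩ := hn.exists_path (fun _ _ _ h => h.isLink) hx
  refine ⟨P, Q.reverse, hP, ?_, hP'.isChain_colour hXY hG, ?_, ?_⟩
  · simpa [Walk.IsPath, Walk.support_reverse] using hQ
  · simpa [Walk.IsAlternating, List.isChain_reverse, ne_comm] using hQ'.isChain_colour hXY hG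
  · simpa [Walk.IsClosedAlternating] using (hP'.append hQ').cycle_chain_colour hXY hG

/-- One alternating path could run entirely against the arcs; the closed walk formed by both paths
yields a circuit through x and y, hence a directed walk the required way. -/
theorem IsColourConnected.exists_diWalk (hXY : Disjoint X Y)
    (hG : ∀ e u v, G.IsLink e u v → (u ∈ X ∧ v ∈ Y) ∨ (u ∈ Y ∧ v ∈ X))
    (h : IsColourConnected G φ) {x y : α} (hx : x ∈ V(G)) (hy : y ∈ V(G)) :
    ∃ l, DiWalk (Arc G φ X Y) x l y := by
  by_cases hxy : x = y
  · exact ⟨[], hxy ▸ .nil x⟩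
  obtain ⟨P, Q, -, -, -, -, hPQ⟩ := h x hx y hy hxy
  obtain ⟨l, -, hl, hlV⟩ := hPQ.exists_circuit hXY hG (by simp [P.edges_ne_nil hxy])
  exact hl.exists_diWalk (Arc.unique hXY hG) (hlV x (Walk.start_mem_support _))
    (hlV y (P.mem_support_append_right _ (Walk.start_mem_support _)))

theorem IsSupereulerian.hasEulerianFactor (h : IsSupereulerian G φ) : HasEulerianFactor G φ := by
  refine ⟨1, fun _ => V(G), fun i j hij => (hij (Subsingleton.elim i j)).elim, Set.iUnion_const _,
    fun _ => ?_⟩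
  rwa [Graph.induce_vertexSet]

/-- Each part contributes one closed trail, whose edges have both ends in that part; disjoint parts
thus give arc-disjoint trails. -/
theorem HasEulerianFactor.exists_circuitCover (hXY : Disjoint X Y)
    (hG : ∀ e u v, G.IsLink e u v → (u ∈ X ∧ v ∈ Y) ∨ (u ∈ Y ∧ v ∈ X))
    (h : HasEulerianFactor G φ) : ∃ L, IsCircuitCover (Arc G φ X Y) V(G) L := by
  obtain ⟨k, W, hW, hWV, hWs⟩ := h
  have key : ∀ i, ∃ l : List β, l.Nodup ∧ IsCircuit (Arc G φ X Y) l ∧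
      (∀ v ∈ W i, Visits (Arc G φ X Y) l v) ∧
      ∀ e ∈ l, ∃ u ∈ W i, ∃ v, G.IsLink e u v ∧ v ∈ W i := by
    intro i
    obtain ⟨x, T, hne, hTn, hT, hTV⟩ := hWs i
    obtain ⟨l, hl, ⟨hlne, y, p⟩, hlV⟩ := hT.exists_circuit hXY
      (fun e u v (h : (G.induce (W i)).IsLink e u v) => hG e u v h.1) hne
    refine ⟨l, hl.nodup_iff.2 hTn, ⟨hlne, y, p.mono fun e u v h => ⟨h.1.1, h.2⟩⟩, ?_, ?_⟩
    · intro v hv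
      obtain ⟨e, he, w, hw⟩ := hlV v (hTV v hv)
      exact ⟨e, he, w, hw.1.1, hw.2⟩
    · intro e he
      obtain ⟨u, v, huv⟩ := T.exists_isLink_of_mem_edges (hl.mem_iff.1 he)
      exact ⟨u, huv.2.1, v, huv.1, huv.2.2⟩
  choose l hln hlc hlV hle using key
  refine ⟨(List.finRange k).map l, ?_, ?_, ?_⟩
  · refine List.nodup_flatten.2 ⟨by simpa using hln, List.pairwise_map.2 ?_⟩
    refine (List.nodup_finRange k).imp fun {i j} hij e hi hj => ?_
    obtain ⟨u, hu, v, huv, hv⟩ := hle i e hi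
    obtain ⟨u', hu', v', huv', hv'⟩ := hle j e hj
    have hd := Set.disjoint_left.1 (hW hij)
    rcases huv.eq_and_eq_or_eq_and_eq huv' with ⟨rfl, rfl⟩ | ⟨rfl, rfl⟩
    exacts [hd hu hu', hd hu hv']
  · simpa using hlc
  · intro v hv
    rw [← hWV] at hv
    obtain ⟨i, hi⟩ := Set.mem_iUnion.1 hv
    exact ⟨l i, List.mem_map.2 ⟨i, List.mem_finRange i, rfl⟩, hlV i v hi⟩

end Orientation
end TwoEdgeColoured

theorem mainTheorem9 {α β : Type*} (G : Graph α β) (hV : V(G).Finite) (hE : E(G).Finite)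
    (φ : β → Fin 2) (hG : TwoEdgeColoured.IsCompleteBipartite G) :
    TwoEdgeColoured.IsSupereulerian G φ ↔
      TwoEdgeColoured.IsColourConnected G φ ∧ TwoEdgeColoured.HasEulerianFactor G φ := by
  obtain ⟨X, Y, hX, -, hXY, hVG, hXX, hYY, hadj⟩ := hG
  have hlink : ∀ e u v, G.IsLink e u v → (u ∈ X ∧ v ∈ Y) ∨ (u ∈ Y ∧ v ∈ X) := by
    intro e u v h
    have hu : u ∈ X ∪ Y := hVG ▸ h.left_mem
    have hv : v ∈ X ∪ Y := hVG ▸ h.right_mem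
    rcases hu with hu | hu <;> rcases hv with hv | hv
    exacts [(hXX u hu v hv ⟨e, h⟩).elim, .inl ⟨hu, hv⟩, .inr ⟨hu, hv⟩, (hYY u hu v hv ⟨e, h⟩).elim]
  refine ⟨fun h => ⟨h.isColourConnected hXY hlink, h.hasEulerianFactor⟩, fun ⟨hc, hf⟩ => ?_⟩
  obtain ⟨l, hl, hn, hlV⟩ := TwoEdgeColoured.exists_spanning_circuit
    (A := TwoEdgeColoured.Arc G φ X Y) hXY (hVG ▸ hV) (hX.mono Set.subset_union_left)
    (TwoEdgeColoured.Arc.unique hXY hlink) (fun e u v h => hlink e u v h.isLink)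
    (fun x hx y hy => by
      obtain ⟨e, he⟩ := hadj x hx y hy
      exact ⟨e, TwoEdgeColoured.Arc.or_symm hlink he⟩)
    (fun u hu v hv => hc.exists_diWalk hXY hlink (hVG ▸ hu) (hVG ▸ hv))
    (hVG ▸ hf.exists_circuitCover hXY hlink)
  exact TwoEdgeColoured.isSupereulerian_of_circuit hXY hlink hl hn (hVG ▸ hlV)
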